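/- Let $H^2(\mathbb{D})$ be the Hardy space of all holomorphic functions $f$ on the open unit disc $\mathbb{D}$ with $$\|f\|_2=\Big(\sup_{0<r<1}\frac1{2\pi}\int_0^{2\pi}|f(re^{i\theta})|^2\,d\theta\Big)^{1/2}<\infty .$$ A bounded linear operator $T$ on a complex normed space $X$ has the \emph{positive shadowing property} if for every $\varepsilon>0$ there is $\delta>0$ such that for every sequence $(x_n)_{n\ge1}$ in $X$ with $\|Tx_n-x_{n+1}\|\le\delta$ for all $n\ge1$ there is $x\in X$ with $\|T^nx-x_n\|\le\varepsilon$ for all $n\ge1$. A \emph{parabolic self-map} of $\mathbb{D}$ is a map $\phi:\mathbb{D}\to\mathbb{D}$ of the form $\phi(z)=\frac{az+b}{cz+d}$ with $a,b,c,d\in\mathbb{C}$ and $ad-bc\ne0$ which, as a transformation of the Riemann sphere $\mathbb{C}\cup\{\infty\}$, has exactly one fixed point; it may or may not be an automorphism of $\mathbb{D}$. \textbf{Theorem.} Let $\phi$ be a parabolic self-map of $\mathbb{D}$. Then the composition operator $C_\phi f=f\circ\phi$ is a bounded linear operator on $H^2(\mathbb{D})$, and it does not have the positive shadowing property. -/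

import Mathlib

noncomputable section

open Complex MeasureTheory Set
open scoped UnitDisc ENNReal

namespace HardyShadowing

/-! ### The Hardy space of the unit disc -/

/-- Extension by zero to the plane of a function on the open unit disc. -/
def discExt (f : 𝔻 → ℂ) (z : ℂ) : ℂ :=
  if h : ‖z‖ < 1 then f (UnitDisc.mk z h) else 0

/-- Holomorphic functions on the open unit disc. -/
def IsHolomorphicOnDisc (f : 𝔻 → ℂ) : Prop :=
  DifferentiableOn ℂ (discExt f) (Metric.ball 0 1)

/-- The integral mean `(1 / 2π) ∫₀^{2π} |f (r e^{iθ})|² dθ`. -/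
def integralMean (f : 𝔻 → ℂ) (r : ℝ) : ℝ≥0∞ :=
  (ENNReal.ofReal (2 * Real.pi))⁻¹ *
    ∫⁻ θ in Ioc 0 (2 * Real.pi), ‖discExt f (circleMap 0 r θ)‖ₑ ^ 2

/-- The Hardy norm `(sup_{0 < r < 1} (1 / 2π) ∫₀^{2π} |f (r e^{iθ})|² dθ)^{1/2}`, possibly `∞`. -/
def eHardyNorm (f : 𝔻 → ℂ) : ℝ≥0∞ :=
  (⨆ r ∈ Ioo (0 : ℝ) 1, integralMean f r) ^ (1 / 2 : ℝ)

/-! #### Facts needed for the normed space structure -/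

/-- The normalized measure on a period. -/
def circMeasure : Measure ℝ :=
  (ENNReal.ofReal (2 * Real.pi))⁻¹ • volume.restrict (Ioc 0 (2 * Real.pi))

theorem discExt_coe (f : 𝔻 → ℂ) (z : 𝔻) : discExt f z = f z := by
  simp [discExt, z.norm_lt_one]

theorem discExt_add (f g : 𝔻 → ℂ) : discExt (f + g) = discExt f + discExt g := by
  ext z; by_cases h : ‖z‖ < 1 <;> simp [discExt, h]

theorem discExt_smul (c : ℂ) (f : 𝔻 → ℂ) : discExt (c • f) = c • discExt f := by
  ext z; by_cases h : ‖z‖ < 1 <;> simp [discExt, h]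

theorem discExt_zero : discExt 0 = 0 := by
  ext z; simp [discExt]

theorem eHardyNorm_eq (f : 𝔻 → ℂ) :
    eHardyNorm f =
      ⨆ r ∈ Ioo (0 : ℝ) 1, eLpNorm (fun θ => discExt f (circleMap 0 r θ)) 2 circMeasure := by
  have h (r : ℝ) : eLpNorm (fun θ => discExt f (circleMap 0 r θ)) 2 circMeasure =
      integralMean f r ^ (1 / 2 : ℝ) := by
    rw [eLpNorm_eq_lintegral_rpow_enorm_toReal (by norm_num) (by norm_num)]
    simp [circMeasure, integralMean, lintegral_smul_measure]
  simp only [h, eHardyNorm]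
  exact (ENNReal.orderIsoRpow (1 / 2 : ℝ) (by norm_num)).map_iSup₂
    (fun (r : ℝ) (_ : r ∈ Ioo (0 : ℝ) 1) => integralMean f r)

theorem continuous_circle {f : 𝔻 → ℂ} (hf : IsHolomorphicOnDisc f) {r : ℝ}
    (hr : r ∈ Ioo (0 : ℝ) 1) : Continuous fun θ => discExt f (circleMap 0 r θ) := by
  refine hf.continuousOn.comp_continuous (continuous_circleMap 0 r) fun θ => ?_
  simp [abs_of_pos hr.1, hr.2]

theorem eHardyNorm_add_le {f g : 𝔻 → ℂ} (hf : IsHolomorphicOnDisc f)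
    (hg : IsHolomorphicOnDisc g) : eHardyNorm (f + g) ≤ eHardyNorm f + eHardyNorm g := by
  simp only [eHardyNorm_eq]
  refine iSup₂_le fun r hr => ?_
  rw [discExt_add]
  refine (eLpNorm_add_le (continuous_circle hf hr).aestronglyMeasurable
    (continuous_circle hg hr).aestronglyMeasurable (by norm_num)).trans ?_
  exact add_le_add
    (le_iSup₂ (f := fun r (_ : r ∈ Ioo (0 : ℝ) 1) =>
      eLpNorm (fun θ => discExt f (circleMap 0 r θ)) 2 circMeasure) r hr)
    (le_iSup₂ (f := fun r (_ : r ∈ Ioo (0 : ℝ) 1) =>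
      eLpNorm (fun θ => discExt g (circleMap 0 r θ)) 2 circMeasure) r hr)

theorem eHardyNorm_smul (c : ℂ) (f : 𝔻 → ℂ) :
    eHardyNorm (c • f) = ‖c‖ₑ * eHardyNorm f := by
  simp only [eHardyNorm_eq, ENNReal.mul_iSup]
  refine iSup_congr fun r => iSup_congr fun _ => ?_
  rw [discExt_smul]
  exact eLpNorm_const_smul c _ 2 _

theorem eHardyNorm_zero : eHardyNorm 0 = 0 := by
  simpa using eHardyNorm_smul 0 0

theorem eq_zero_of_eHardyNorm_eq_zero {f : 𝔻 → ℂ} (hf : IsHolomorphicOnDisc f)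
    (h : eHardyNorm f = 0) : f = 0 := by
  have key : ∀ z : ℂ, z ≠ 0 → discExt f z = 0 := by
    intro z hz
    by_cases hz1 : ‖z‖ < 1
    swap
    · simp [discExt, hz1]
    have hr : ‖z‖ ∈ Ioo (0 : ℝ) 1 := ⟨norm_pos_iff.2 hz, hz1⟩
    have hc := continuous_circle hf hr
    have hsup : (⨆ r ∈ Ioo (0 : ℝ) 1, integralMean f r) = 0 := by
      exact (ENNReal.rpow_eq_zero_iff_of_pos (by norm_num)).1 h
    have h0 : integralMean f ‖z‖ = 0 :=
      le_antisymm (hsup ▸ le_iSup₂ (f := fun r (_ : r ∈ Ioo (0 : ℝ) 1) => integralMean f r)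
        _ hr) bot_le
    have h1 : ∫⁻ θ in Ioc 0 (2 * Real.pi), ‖discExt f (circleMap 0 ‖z‖ θ)‖ₑ ^ 2 = 0 := by
      exact (mul_eq_zero.1 h0).resolve_left (ENNReal.inv_ne_zero.2 ENNReal.ofReal_ne_top)
    rw [lintegral_eq_zero_iff (hc.measurable.enorm.pow_const 2)] at h1
    have h2 : (fun θ => discExt f (circleMap 0 ‖z‖ θ))
        =ᵐ[volume.restrict (Ioc 0 (2 * Real.pi))] fun _ => 0 := by
      filter_upwards [h1] with θ hθ
      simpa using hθ
    have h3 := Measure.eqOn_Ioc_of_ae_eq volume h2 hc.continuousOn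
      continuousOn_const
    have h4 : z ∈ circleMap 0 ‖z‖ '' Ioc 0 (2 * Real.pi) := by
      simp [image_circleMap_Ioc]
    obtain ⟨θ, hθ, hzθ⟩ := h4
    simpa [hzθ] using h3 hθ
  have h0 : discExt f 0 = 0 := by
    have hc : ContinuousAt (discExt f) 0 :=
      (hf.differentiableAt (Metric.ball_mem_nhds 0 one_pos)).continuousAt
    refine tendsto_nhds_unique (hc.tendsto.mono_left (nhdsWithin_le_nhds (s := {0}ᶜ))) ?_
    refine tendsto_const_nhds.congr' ?_
    filter_upwards [self_mem_nhdsWithin] with z hz using (key z hz).symm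
  ext z
  rw [← discExt_coe f z]
  by_cases hz : (z : ℂ) = 0
  · rw [hz, h0]; rfl
  · exact key _ hz

/-- The functions in `H²(𝔻)`, as a linear subspace of all functions on the disc. -/
def hardySubmodule : Submodule ℂ (𝔻 → ℂ) where
  carrier := {f | IsHolomorphicOnDisc f ∧ eHardyNorm f < ⊤}
  zero_mem' := by
    refine ⟨?_, by simp [eHardyNorm_zero]⟩
    rw [IsHolomorphicOnDisc, discExt_zero]
    exact differentiableOn_const 0
  add_mem' := by
    rintro f g ⟨hf, hf'⟩ ⟨hg, hg'⟩
    refine ⟨?_, (eHardyNorm_add_le hf hg).trans_lt (ENNReal.add_lt_top.2 ⟨hf', hg'⟩)⟩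
    rw [IsHolomorphicOnDisc, discExt_add]
    exact DifferentiableOn.add hf hg
  smul_mem' := by
    rintro c f ⟨hf, hf'⟩
    refine ⟨?_, ?_⟩
    · rw [IsHolomorphicOnDisc, discExt_smul]
      exact DifferentiableOn.const_smul hf c
    · rw [eHardyNorm_smul]
      exact ENNReal.mul_lt_top (by simp) hf'

/-- The Hardy space `H²(𝔻)`; its topology is the one given by the Hardy norm below (not the
topology of pointwise convergence inherited from `𝔻 → ℂ`). -/
def HardySpace : Type := hardySubmodule

namespace HardySpace

instance : AddCommGroup HardySpace := inferInstanceAs (AddCommGroup hardySubmodule)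

instance : Module ℂ HardySpace := inferInstanceAs (Module ℂ hardySubmodule)

instance : CoeFun HardySpace fun _ => 𝔻 → ℂ := ⟨fun f => Subtype.val f⟩

/-- The Hardy norm. -/
instance : Norm HardySpace := ⟨fun f => (eHardyNorm f).toReal⟩

theorem norm_def (f : HardySpace) : ‖f‖ = (eHardyNorm f).toReal := rfl

theorem ext {f g : HardySpace} (h : ∀ z, f z = g z) : f = g := Subtype.ext (funext h)

theorem normCore : NormedSpace.Core ℂ HardySpace where
  norm_nonneg _ := ENNReal.toReal_nonneg
  norm_smul c f := by
    have : eHardyNorm (c • f : HardySpace) = ‖c‖ₑ * eHardyNorm f := eHardyNorm_smul c f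
    simp [norm_def, this]
  norm_triangle f g := by
    simp only [norm_def]
    rw [← ENNReal.toReal_add f.2.2.ne g.2.2.ne]
    exact ENNReal.toReal_mono (ENNReal.add_ne_top.2 ⟨f.2.2.ne, g.2.2.ne⟩)
      (eHardyNorm_add_le f.2.1 g.2.1)
  norm_eq_zero_iff f := by
    constructor
    · intro h
      have h' : eHardyNorm f = 0 :=
        ((ENNReal.toReal_eq_zero_iff _).1 h).resolve_right f.2.2.ne
      exact Subtype.ext (eq_zero_of_eHardyNorm_eq_zero f.2.1 h')
    · rintro rfl
      have : eHardyNorm (0 : HardySpace) = 0 := eHardyNorm_zero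
      simp [norm_def, this]

instance : NormedAddCommGroup HardySpace := NormedAddCommGroup.ofCore normCore

instance : NormedSpace ℂ HardySpace := NormedSpace.ofCore normCore

end HardySpace

/-! ### Shadowing -/

/-- A `δ`-pseudo-orbit `(x_n)_{n ≥ 1}` of `T` (the value `x 0` plays no role). -/
def IsPseudoOrbit {X : Type*} [NormedAddCommGroup X] [NormedSpace ℂ X] (T : X →L[ℂ] X) (δ : ℝ)
    (x : ℕ → X) : Prop :=
  ∀ n, 1 ≤ n → ‖T (x n) - x (n + 1)‖ ≤ δ

/-- The positive shadowing property. -/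
def HasPositiveShadowing {X : Type*} [NormedAddCommGroup X] [NormedSpace ℂ X]
    (T : X →L[ℂ] X) : Prop :=
  ∀ ε > 0, ∃ δ > 0, ∀ x : ℕ → X, IsPseudoOrbit T δ x →
    ∃ y : X, ∀ n, 1 ≤ n → ‖(T ^ n) y - x n‖ ≤ ε

/-! ### Composition operators and parabolic self-maps -/

/-- `T` is the composition operator `C_φ f = f ∘ φ` on `H²(𝔻)`. -/
def IsCompositionOperator (φ : 𝔻 → 𝔻) (T : HardySpace →L[ℂ] HardySpace) : Prop :=
  ∀ (f : HardySpace) (z : 𝔻), T f z = f (φ z)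

theorem IsCompositionOperator.unique {φ : 𝔻 → 𝔻} {S T : HardySpace →L[ℂ] HardySpace}
    (hS : IsCompositionOperator φ S) (hT : IsCompositionOperator φ T) : S = T :=
  ContinuousLinearMap.ext fun f => HardySpace.ext fun z => (hS f z).trans (hT f z).symm

/-- `φ` is the restriction to the disc of the Möbius transformation `z ↦ (a z + b) / (c z + d)`
of the Riemann sphere `OnePoint ℂ` given by the invertible matrix `g = (a b; c d)`. -/
def IsInducedBy (φ : 𝔻 → 𝔻) (g : GL (Fin 2) ℂ) : Prop :=
  ∀ z : 𝔻, g • ((z : ℂ) : OnePoint ℂ) = ((φ z : ℂ) : OnePoint ℂ)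

theorem isInducedBy_iff (φ : 𝔻 → 𝔻) (g : GL (Fin 2) ℂ) :
    IsInducedBy φ g ↔ ∀ z : 𝔻, g 1 0 * z + g 1 1 ≠ 0 ∧
      (φ z : ℂ) = (g 0 0 * z + g 0 1) / (g 1 0 * z + g 1 1) := by
  refine forall_congr' fun z => ?_
  rw [OnePoint.smul_some_eq_ite]
  by_cases h : g 1 0 * (z : ℂ) + g 1 1 = 0
  · simp [h, OnePoint.infty_ne_coe]
  · simp [h, eq_comm]

/-- A parabolic self-map of the disc: a linear fractional self-map with exactly one fixed point
on the Riemann sphere. -/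
def IsParabolicSelfMap (φ : 𝔻 → 𝔻) : Prop :=
  ∃ g : GL (Fin 2) ℂ, IsInducedBy φ g ∧ ∃! p : OnePoint ℂ, g • p = p

end HardyShadowing

end

noncomputable section

open Complex MeasureTheory Set
open scoped UnitDisc ENNReal

namespace HardyShadowing

/-! ### Integral means and subordination -/

/-! Shadowing fails because constants are fixed by `C_φ`. For small `d > 0` the constant functions
`d * n` form a pseudo-orbit that drifts linearly in `n`. Suppose `y` in `H²` shadowed it within `1`.
Evaluation at `0` is a contraction on `H²`, so `y (φ^[n] 0)` would stay within `1` of `d * n`. Two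
estimates exclude this. By `IsParabolicSelfMap.exists_le_one_sub_norm_sq`, `1 - |φ^[n] 0|²` is at
least `c / n²`. By `HardySpace.exists_norm_apply_le`, a function in `H²` is `o((1 - |z|²)^(-1/2))`,
so `y (φ^[n] 0) = o(n)`. It matters that this is little-o: a big-O bound would only give linear
growth, which is no contradiction.

Boundedness is Littlewood subordination, here with the non-sharp constant `4 / (1 - |φ 0|)`: `|F|²`
is dominated by its Poisson integral, and after exchanging integrals the Poisson kernel composed
with `φ` is averaged by the mean value property. -/

theorem integralMean_eq {f : 𝔻 → ℂ} (hf : IsHolomorphicOnDisc f) {r : ℝ}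
    (hr : r ∈ Ioo (0 : ℝ) 1) :
    integralMean f r =
      ENNReal.ofReal (Real.circleAverage (fun z => ‖discExt f z‖ ^ 2) 0 r) := by
  have hc : Continuous fun θ => ‖discExt f (circleMap 0 r θ)‖ ^ 2 :=
    (continuous_circle hf hr).norm.pow 2
  rw [Real.circleAverage_def, intervalIntegral.integral_of_le Real.two_pi_pos.le, smul_eq_mul,
    ENNReal.ofReal_mul (by positivity), ofReal_integral_eq_lintegral_ofReal
      (hc.integrableOn_Ioc) (Filter.Eventually.of_forall fun θ => by positivity),
    integralMean, ENNReal.ofReal_inv_of_pos Real.two_pi_pos]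
  congr 1
  refine lintegral_congr fun θ => ?_
  rw [ENNReal.ofReal_pow (norm_nonneg _), ofReal_norm]

/-- The Poisson formula is applied to the holomorphic function `F ^ 2` rather than to `F`. Since the
kernel is nonnegative, the triangle inequality for integrals then suffices, without Jensen or
Cauchy–Schwarz. -/
theorem norm_sq_le_circleAverage {F : ℂ → ℂ} (hF : DifferentiableOn ℂ F (Metric.ball 0 1))
    {ρ : ℝ} (hρ : ρ ∈ Ioo (0 : ℝ) 1) {w : ℂ} (hw : ‖w‖ < ρ) :
    ‖F w‖ ^ 2 ≤ Real.circleAverage (fun ζ => ((ζ + w) / (ζ - w)).re * ‖F ζ‖ ^ 2) 0 ρ := by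
  have hsub : Metric.closedBall (0 : ℂ) ρ ⊆ Metric.ball 0 1 :=
    Metric.closedBall_subset_ball hρ.2
  have hw' : w ∈ Metric.ball (0 : ℂ) ρ := by simpa using hw
  have hd : DiffContOnCl ℂ (fun z => F z ^ 2) (Metric.ball 0 ρ) := by
    refine DifferentiableOn.diffContOnCl ?_
    rw [closure_ball 0 hρ.1.ne']
    exact (hF.mono hsub).pow 2
  have h := hd.circleAverage_re_herglotzRieszKernel_smul hw'
  have h' : F w ^ 2 =
      Real.circleAverage (fun ζ => (((ζ + w) / (ζ - w)).re : ℝ) • F ζ ^ 2) 0 ρ := by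
    rw [← h]
    congr 1
    ext ζ
    simp [herglotzRieszKernel_def]
  rw [← norm_pow, h', Real.circleAverage_def, Real.circleAverage_def, norm_smul, smul_eq_mul,
    Real.norm_of_nonneg (by positivity)]
  gcongr
  refine (intervalIntegral.norm_integral_le_integral_norm Real.two_pi_pos.le).trans_eq ?_
  refine intervalIntegral.integral_congr fun θ _ => ?_
  have hnn : 0 ≤ ((circleMap 0 ρ θ + w) / (circleMap 0 ρ θ - w)).re := by
    have := le_re_herglotzRieszKernel (circleMap_mem_sphere 0 hρ.1.le θ) hw'
    simp only [sub_zero] at this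
    refine le_trans ?_ this
    exact div_nonneg (by linarith) (by linarith [norm_nonneg w, hρ.1])
  simp only [norm_smul, norm_pow, Real.norm_of_nonneg hnn]

/-- A Schur-type bound: an integral operator whose kernel has bounded column averages is bounded
on averages of nonnegative functions. -/
theorem average_le_of_kernel {K : ℝ → ℝ → ℝ} (hK : Continuous (Function.uncurry K)) {u v : ℝ → ℝ}
    (hu : Continuous u) (hv : Continuous v) (hv0 : ∀ t, 0 ≤ v t) {M : ℝ}
    (huv : ∀ θ, u θ ≤ (2 * Real.pi)⁻¹ * ∫ t in 0..2 * Real.pi, K θ t * v t)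
    (hM : ∀ t, (2 * Real.pi)⁻¹ * ∫ θ in 0..2 * Real.pi, K θ t ≤ M) :
    (2 * Real.pi)⁻¹ * ∫ θ in 0..2 * Real.pi, u θ ≤
      M * ((2 * Real.pi)⁻¹ * ∫ t in 0..2 * Real.pi, v t) := by
  have hK' : Continuous (Function.uncurry fun t θ => K θ t) := hK.comp continuous_swap
  have hKv : Continuous (Function.uncurry fun θ t => K θ t * v t) :=
    hK.mul (hv.comp continuous_snd)
  calc (2 * Real.pi)⁻¹ * ∫ θ in 0..2 * Real.pi, u θ
      ≤ (2 * Real.pi)⁻¹ * ∫ θ in 0..2 * Real.pi,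
          (2 * Real.pi)⁻¹ * ∫ t in 0..2 * Real.pi, K θ t * v t := by
        refine mul_le_mul_of_nonneg_left ?_ (by positivity)
        refine intervalIntegral.integral_mono_on Real.two_pi_pos.le
          (hu.intervalIntegrable _ _) ?_ fun θ _ => huv θ
        refine Continuous.intervalIntegrable ?_ _ _
        exact continuous_const.mul
          (intervalIntegral.continuous_parametric_intervalIntegral_of_continuous' hKv _ _)
    _ = (2 * Real.pi)⁻¹ * ∫ t in 0..2 * Real.pi,
          ((2 * Real.pi)⁻¹ * ∫ θ in 0..2 * Real.pi, K θ t) * v t := by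
        rw [intervalIntegral.integral_const_mul, intervalIntegral_intervalIntegral_swap,
          ← intervalIntegral.integral_const_mul]
        · congr 1
          refine intervalIntegral.integral_congr fun t _ => ?_
          simp only [intervalIntegral.integral_mul_const, mul_assoc]
        · exact (hKv.continuousOn.integrableOn_compact
            (isCompact_uIcc.prod isCompact_uIcc)).mono_set
            (prod_mono uIoc_subset_uIcc uIoc_subset_uIcc)
    _ ≤ (2 * Real.pi)⁻¹ * ∫ t in 0..2 * Real.pi, M * v t := by
        refine mul_le_mul_of_nonneg_left ?_ (by positivity)
        refine intervalIntegral.integral_mono_on Real.two_pi_pos.le ?_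
          ((continuous_const.mul hv).intervalIntegrable _ _)
          fun t _ => mul_le_mul_of_nonneg_right (hM t) (hv0 t)
        refine Continuous.intervalIntegrable ?_ _ _
        refine (continuous_const.mul ?_).mul hv
        exact intervalIntegral.continuous_parametric_intervalIntegral_of_continuous' hK' _ _
    _ = M * ((2 * Real.pi)⁻¹ * ∫ t in 0..2 * Real.pi, v t) := by
        rw [intervalIntegral.integral_const_mul]
        ring

/-- Littlewood's subordination principle for integral means. -/
theorem circleAverage_norm_sq_comp_le {F G : ℂ → ℂ}
    (hF : DifferentiableOn ℂ F (Metric.ball 0 1)) (hG : DifferentiableOn ℂ G (Metric.ball 0 1))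
    (hGm : MapsTo G (Metric.ball 0 1) (Metric.ball 0 1)) {r : ℝ} (hr : r ∈ Ioo (0 : ℝ) 1) :
    ∃ ρ ∈ Ioo (0 : ℝ) 1, Real.circleAverage (fun z => ‖F (G z)‖ ^ 2) 0 r ≤
      4 / (1 - ‖G 0‖) * Real.circleAverage (fun z => ‖F z‖ ^ 2) 0 ρ := by
  have hsub : Metric.closedBall (0 : ℂ) r ⊆ Metric.ball 0 1 :=
    Metric.closedBall_subset_ball hr.2
  have hG0 : ‖G 0‖ < 1 := by simpa using hGm (Metric.mem_ball_self one_pos)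
  -- The first bound keeps the Poisson kernel nonsingular on the image of the closed disc of radius
  -- `r`. The second gives `ρ - ‖G 0‖ ≥ (1 - ‖G 0‖) / 2`, which with `ρ + ‖G 0‖ ≤ 2` yields the
  -- constant `4 / (1 - ‖G 0‖)`.
  obtain ⟨ρ, hρ, hGρ, hρ0⟩ : ∃ ρ ∈ Ioo (0 : ℝ) 1,
      (∀ z ∈ Metric.closedBall (0 : ℂ) r, ‖G z‖ < ρ) ∧ (1 + ‖G 0‖) / 2 ≤ ρ := by
    obtain ⟨z₀, hz₀, hmax⟩ := (isCompact_closedBall (0 : ℂ) r).exists_isMaxOn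
      ⟨0, by simpa using hr.1.le⟩ (hG.mono hsub).continuousOn.norm
    have h1 : ‖G z₀‖ < 1 := by simpa using hGm (hsub hz₀)
    refine ⟨max ((1 + ‖G z₀‖) / 2) ((1 + ‖G 0‖) / 2), ⟨?_, ?_⟩, ?_, le_max_right _ _⟩
    · exact lt_max_of_lt_left (by positivity)
    · exact max_lt (by linarith) (by linarith)
    · intro z hz
      have := hmax hz
      simp only [mem_ofPred_eq] at this
      exact lt_max_of_lt_left (by linarith)
  refine ⟨ρ, hρ, ?_⟩
  have hcirc (θ : ℝ) : circleMap 0 r θ ∈ Metric.closedBall (0 : ℂ) r :=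
    circleMap_mem_closedBall 0 hr.1.le θ
  have hcircρ (t : ℝ) : ‖circleMap 0 ρ t‖ = ρ := by simp [abs_of_pos hρ.1]
  have hne {z : ℂ} (hz : z ∈ Metric.closedBall (0 : ℂ) r) (t : ℝ) :
      circleMap 0 ρ t - G z ≠ 0 := fun h => by
    have := hGρ z hz
    rw [← sub_eq_zero.1 h, hcircρ] at this
    exact this.false
  have hGc : Continuous fun θ => G (circleMap 0 r θ) :=
    hG.continuousOn.comp_continuous (continuous_circleMap 0 r) fun θ => hsub (hcirc θ)
  have hFc : Continuous fun t => F (circleMap 0 ρ t) :=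
    hF.continuousOn.comp_continuous (continuous_circleMap 0 ρ) fun t => by
      simp [abs_of_pos hρ.1, hρ.2]
  have hFGc : Continuous fun θ => F (G (circleMap 0 r θ)) :=
    hF.continuousOn.comp_continuous hGc fun θ => hGm (hsub (hcirc θ))
  have hKc : Continuous (Function.uncurry fun θ t : ℝ =>
      ((circleMap 0 ρ t + G (circleMap 0 r θ)) / (circleMap 0 ρ t - G (circleMap 0 r θ))).re) := by
    refine continuous_re.comp (Continuous.div ?_ ?_ fun p => hne (hcirc p.1) p.2)
    · exact ((continuous_circleMap 0 ρ).comp continuous_snd).add (hGc.comp continuous_fst)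
    · exact ((continuous_circleMap 0 ρ).comp continuous_snd).sub (hGc.comp continuous_fst)
  -- For fixed `t` the kernel is the real part of a holomorphic function of `z`, so its average is
  -- its value at `z = 0`, bounded by Harnack's `(ρ + ‖G 0‖) / (ρ - ‖G 0‖)`.
  have hinner (t : ℝ) : (2 * Real.pi)⁻¹ * ∫ θ in 0..2 * Real.pi,
      ((circleMap 0 ρ t + G (circleMap 0 r θ)) / (circleMap 0 ρ t - G (circleMap 0 r θ))).re ≤
        4 / (1 - ‖G 0‖) := by
    have hd : DiffContOnCl ℂ (fun z => (circleMap 0 ρ t + G z) / (circleMap 0 ρ t - G z))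
        (Metric.ball 0 |r|) := by
      rw [abs_of_pos hr.1]
      refine DifferentiableOn.diffContOnCl ?_
      rw [closure_ball 0 hr.1.ne']
      exact ((hG.mono hsub).const_add _).div ((hG.mono hsub).const_sub _) fun z hz => hne hz t
    have hmv := hd.circleAverage
    have hci : CircleIntegrable
        (fun z => (circleMap 0 ρ t + G z) / (circleMap 0 ρ t - G z)) 0 r := by
      refine ContinuousOn.circleIntegrable hr.1.le ?_
      have := hd.continuousOn
      rw [abs_of_pos hr.1, closure_ball 0 hr.1.ne'] at this
      exact this.mono Metric.sphere_subset_closedBall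
    have hre := Complex.reCLM.circleAverage_comp_comm hci
    rw [hmv, Real.circleAverage_def, smul_eq_mul] at hre
    have hle := re_herglotzRieszKernel_le (circleMap_mem_sphere (0 : ℂ) hρ.1.le t)
      (show G 0 ∈ Metric.ball (0 : ℂ) ρ by simpa using hGρ 0 (by simpa using hr.1.le))
    simp only [sub_zero] at hle
    refine (hre.le.trans hle).trans ?_
    rw [div_le_div_iff₀ (by linarith) (by linarith)]
    nlinarith [hρ.2]
  simp only [Real.circleAverage_def, smul_eq_mul]
  exact average_le_of_kernel hKc (hFGc.norm.pow 2) (hFc.norm.pow 2) (fun t => sq_nonneg _)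
    (fun θ => norm_sq_le_circleAverage hF hρ (hGρ _ (hcirc θ))) hinner

/-! ### Boundedness of composition operators -/

theorem discExt_comp {f : 𝔻 → ℂ} {φ : 𝔻 → 𝔻} {z : ℂ} (hz : ‖z‖ < 1) :
    discExt (f ∘ φ) z = discExt f (discExt (fun w => (φ w : ℂ)) z) := by
  have h : discExt (fun w => (φ w : ℂ)) z = φ (UnitDisc.mk z hz) := by simp [discExt, hz]
  rw [h, discExt_coe]
  simp [discExt, hz]

theorem mapsTo_discExt_coe (φ : 𝔻 → 𝔻) :
    MapsTo (discExt fun w => (φ w : ℂ)) (Metric.ball 0 1) (Metric.ball 0 1) := by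
  intro z hz
  have hz' : ‖z‖ < 1 := by simpa using hz
  simpa [discExt, hz'] using (φ (UnitDisc.mk z hz')).norm_lt_one

theorem IsHolomorphicOnDisc.comp {f : 𝔻 → ℂ} {φ : 𝔻 → 𝔻} (hf : IsHolomorphicOnDisc f)
    (hφ : IsHolomorphicOnDisc fun z => (φ z : ℂ)) : IsHolomorphicOnDisc (f ∘ φ) :=
  (DifferentiableOn.comp hf hφ (mapsTo_discExt_coe φ)).congr fun z hz =>
    discExt_comp (by simpa using hz)

theorem eHardyNorm_comp_le {f : 𝔻 → ℂ} {φ : 𝔻 → 𝔻} (hf : IsHolomorphicOnDisc f)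
    (hφ : IsHolomorphicOnDisc fun z => (φ z : ℂ)) :
    eHardyNorm (f ∘ φ) ≤
      ENNReal.ofReal (4 / (1 - ‖(φ 0 : ℂ)‖)) ^ (1 / 2 : ℝ) * eHardyNorm f := by
  have hpos : 0 < 4 / (1 - ‖(φ 0 : ℂ)‖) :=
    div_pos four_pos (sub_pos.2 (φ 0).norm_lt_one)
  rw [eHardyNorm, eHardyNorm, ← ENNReal.mul_rpow_of_nonneg _ _ (by norm_num)]
  refine ENNReal.rpow_le_rpow (iSup₂_le fun r hr => ?_) (by norm_num)
  obtain ⟨ρ, hρ, h⟩ := circleAverage_norm_sq_comp_le hf hφ (mapsTo_discExt_coe φ) hr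
  have h0 : discExt (fun z => (φ z : ℂ)) 0 = φ 0 := by
    simpa using discExt_coe (fun z => (φ z : ℂ)) 0
  rw [h0] at h
  have hcongr : Real.circleAverage (fun z => ‖discExt (f ∘ φ) z‖ ^ 2) 0 r =
      Real.circleAverage (fun z => ‖discExt f (discExt (fun w => (φ w : ℂ)) z)‖ ^ 2) 0 r := by
    refine Real.circleAverage_congr_sphere fun z hz => ?_
    have hz' : ‖z‖ < 1 := by
      have : ‖z‖ = r := by simpa [abs_of_pos hr.1] using hz
      rw [this]; exact hr.2
    simp only [discExt_comp hz']
  calc integralMean (f ∘ φ) r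
      ≤ ENNReal.ofReal (4 / (1 - ‖(φ 0 : ℂ)‖)) * integralMean f ρ := by
        rw [integralMean_eq (hf.comp hφ) hr, integralMean_eq hf hρ, hcongr,
          ← ENNReal.ofReal_mul hpos.le]
        exact ENNReal.ofReal_le_ofReal h
    _ ≤ _ := by
        gcongr
        exact le_iSup₂ (f := fun r (_ : r ∈ Ioo (0 : ℝ) 1) => integralMean f r) ρ hρ

/-- Every holomorphic self-map of the disc induces a bounded composition operator. -/
theorem exists_isCompositionOperator {φ : 𝔻 → 𝔻}
    (hφ : IsHolomorphicOnDisc fun z => (φ z : ℂ)) :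
    ∃ T : HardySpace →L[ℂ] HardySpace, IsCompositionOperator φ T := by
  set C : ℝ≥0∞ := ENNReal.ofReal (4 / (1 - ‖(φ 0 : ℂ)‖)) ^ (1 / 2 : ℝ) with hC
  have hCtop : C ≠ ⊤ := ENNReal.rpow_ne_top_of_nonneg (by norm_num) ENNReal.ofReal_ne_top
  have hle (f : HardySpace) : eHardyNorm (f ∘ φ) ≤ C * eHardyNorm f :=
    eHardyNorm_comp_le f.2.1 hφ
  have hlt (f : HardySpace) : C * eHardyNorm f < ⊤ := ENNReal.mul_lt_top hCtop.lt_top f.2.2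
  let L : HardySpace →ₗ[ℂ] HardySpace :=
    { toFun := fun f => ⟨f ∘ φ, f.2.1.comp hφ, (hle f).trans_lt (hlt f)⟩
      map_add' := fun f g => rfl
      map_smul' := fun c f => rfl }
  refine ⟨L.mkContinuous C.toReal fun f => ?_, fun f z => rfl⟩
  rw [HardySpace.norm_def, HardySpace.norm_def, ← ENNReal.toReal_mul]
  exact ENNReal.toReal_mono (hlt f).ne (hle f)

/-! ### Taylor coefficients and growth -/

/-- Uniqueness of power series makes the Cauchy coefficients independent of the radius, so radius `1
/ 2` can define `a`. On each circle Cauchy's coefficient integral is a Fourier integral. -/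
theorem exists_hasSum_fourierCoeffOn {F : ℂ → ℂ} (hF : DifferentiableOn ℂ F (Metric.ball 0 1)) :
    ∃ a : ℕ → ℂ, (∀ z, ‖z‖ < 1 → HasSum (fun k => a k * z ^ k) (F z)) ∧
      ∀ r ∈ Ioo (0 : ℝ) 1, ∀ k : ℕ,
        a k * r ^ k = fourierCoeffOn Real.two_pi_pos (fun θ => F (circleMap 0 r θ)) k := by
  have hps {r : ℝ} (hr : r ∈ Ioo (0 : ℝ) 1) :
      HasFPowerSeriesOnBall F (cauchyPowerSeries F 0 r) 0 (ENNReal.ofReal r) := by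
    have := (hF.mono (Metric.closedBall_subset_ball hr.2)).hasFPowerSeriesOnBall
      (R := ⟨r, hr.1.le⟩) hr.1
    rwa [ENNReal.ofReal, Real.toNNReal_of_nonneg hr.1.le]
  have h2 : (1 / 2 : ℝ) ∈ Ioo (0 : ℝ) 1 := by norm_num
  have heq {r : ℝ} (hr : r ∈ Ioo (0 : ℝ) 1) :
      cauchyPowerSeries F 0 (1 / 2) = cauchyPowerSeries F 0 r :=
    (hps h2).hasFPowerSeriesAt.eq_formalMultilinearSeries (hps hr).hasFPowerSeriesAt
  refine ⟨fun k => (cauchyPowerSeries F 0 (1 / 2)).coeff k, fun z hz => ?_, fun r hr k => ?_⟩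
  · have hr : (1 + ‖z‖) / 2 ∈ Ioo (0 : ℝ) 1 := ⟨by positivity, by linarith⟩
    have h := (hps hr).hasSum (y := z) (by
      rw [Metric.eball_ofReal]
      simp only [Metric.mem_ball, dist_zero_right]
      linarith)
    rw [← heq hr, zero_add] at h
    refine h.congr_fun fun k => ?_
    simp [mul_comm]
  · have h : (cauchyPowerSeries F 0 (1 / 2)).coeff k * (r : ℂ) ^ k =
        cauchyPowerSeries F 0 r k fun _ => (r : ℂ) := by
      rw [heq hr]
      simp [mul_comm]
    simp only [h]
    rw [cauchyPowerSeries_apply, fourierCoeffOn_eq_integral, circleIntegral]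
    have hpt (θ : ℝ) : deriv (circleMap 0 r) θ • ((r : ℂ) / (circleMap 0 r θ - 0)) ^ k •
        (circleMap 0 r θ - 0)⁻¹ • F (circleMap 0 r θ) =
        I * (fourier (-(k : ℤ)) (θ : AddCircle (2 * Real.pi - 0)) • F (circleMap 0 r θ)) := by
      have hr0 : (r : ℂ) ≠ 0 := ofReal_ne_zero.2 hr.1.ne'
      have hexp : fourier (-(k : ℤ)) (θ : AddCircle (2 * Real.pi - 0)) =
          (exp (θ * I))⁻¹ ^ k := by
        rw [fourier_coe_apply, ← Complex.exp_neg, ← Complex.exp_nat_mul]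
        congr 1
        have : (Real.pi : ℂ) ≠ 0 := ofReal_ne_zero.2 Real.pi_ne_zero
        push_cast
        field_simp
        ring
      rw [hexp, deriv_circleMap]
      simp only [circleMap, zero_add, sub_zero, smul_eq_mul]
      field_simp
    simp only [hpt, intervalIntegral.integral_const_mul]
    rw [smul_eq_mul, real_smul]
    have : (Real.pi : ℂ) ≠ 0 := ofReal_ne_zero.2 Real.pi_ne_zero
    simp only [sub_zero]
    push_cast
    field_simp

/-- Parseval on the circle of radius `r` bounds the sums of `‖a k‖² r^(2k)` by the integral mean;
then `r` tends to `1`. -/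
theorem HardySpace.exists_hasSum (f : HardySpace) :
    ∃ a : ℕ → ℂ, (∀ z : 𝔻, HasSum (fun k => a k * (z : ℂ) ^ k) (f z)) ∧
      ∀ s : Finset ℕ, ∑ k ∈ s, ‖a k‖ ^ 2 ≤ ‖f‖ ^ 2 := by
  obtain ⟨a, ha, hcoeff⟩ := exists_hasSum_fourierCoeffOn f.2.1
  refine ⟨a, fun z => ?_, fun s => ?_⟩
  · simpa only [discExt_coe] using ha z z.norm_lt_one
  have hbound : ∀ r ∈ Ioo (0 : ℝ) 1, ∑ k ∈ s, ‖a k * r ^ k‖ ^ 2 ≤ ‖f‖ ^ 2 := by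
    intro r hr
    have hc := continuous_circle f.2.1 hr
    have hL2 : MemLp (fun θ => discExt f (circleMap 0 r θ)) 2
        (volume.restrict (Ioc 0 (2 * Real.pi))) :=
      (memLp_two_iff_integrable_sq_norm hc.aestronglyMeasurable).2 (hc.norm.pow 2).integrableOn_Ioc
    have hsum := hasSum_sq_fourierCoeffOn Real.two_pi_pos hL2
    have hmean : (2 * Real.pi - 0)⁻¹ • ∫ θ in 0..2 * Real.pi, ‖discExt f (circleMap 0 r θ)‖ ^ 2 =
        Real.circleAverage (fun z => ‖discExt f z‖ ^ 2) 0 r := by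
      rw [Real.circleAverage_def, sub_zero]
    have hle : Real.circleAverage (fun z => ‖discExt f z‖ ^ 2) 0 r ≤ ‖f‖ ^ 2 := by
      have h1 : integralMean f r ≤ eHardyNorm f ^ 2 := by
        rw [eHardyNorm, ← ENNReal.rpow_natCast, ← ENNReal.rpow_mul]
        norm_num
        exact le_iSup₂ (f := fun r (_ : r ∈ Ioo (0 : ℝ) 1) => integralMean f r) r hr
      rw [integralMean_eq f.2.1 hr] at h1
      rw [HardySpace.norm_def, ← ENNReal.toReal_pow]
      exact (ENNReal.ofReal_le_iff_le_toReal (ENNReal.pow_ne_top f.2.2.ne)).1 h1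
    rw [hmean] at hsum
    refine le_trans ?_ hle
    -- Fourier coefficients outside the finite set `s`, including all those of negative index, are
    -- simply discarded.
    have := sum_le_hasSum (s.map Nat.castEmbedding) (fun i _ => by positivity) hsum
    simpa [← hcoeff r hr] using this
  have hlim : Filter.Tendsto (fun r : ℝ => ∑ k ∈ s, ‖a k * (r : ℂ) ^ k‖ ^ 2)
      (nhdsWithin 1 (Iio 1)) (nhds (∑ k ∈ s, ‖a k‖ ^ 2)) := by
    have hcont : Continuous fun r : ℝ => ∑ k ∈ s, ‖a k * (r : ℂ) ^ k‖ ^ 2 := by fun_prop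
    simpa using (hcont.tendsto 1).mono_left nhdsWithin_le_nhds
  refine le_of_tendsto hlim ?_
  filter_upwards [Ioo_mem_nhdsLT (zero_lt_one' ℝ)] with r hr using hbound r hr

theorem HardySpace.norm_apply_zero_le (f : HardySpace) : ‖f 0‖ ≤ ‖f‖ := by
  obtain ⟨a, ha, hs⟩ := f.exists_hasSum
  have h0 : a 0 = f 0 := by
    refine (hasSum_single 0 fun k hk => ?_).unique (by simpa using ha 0) |>.symm ▸ ?_
    all_goals simp_all
  have := hs {0}
  rw [Finset.sum_singleton, h0] at this
  exact (sq_le_sq₀ (norm_nonneg _) (norm_nonneg _)).1 this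

/-- Functions in `H²` are `o((1 - |z|²)^{-1/2})` at the boundary. -/
theorem HardySpace.exists_norm_apply_le (f : HardySpace) {η : ℝ} (hη : 0 < η) :
    ∃ C : ℝ, ∀ z : 𝔻, ‖f z‖ ≤ C + η / √(1 - ‖(z : ℂ)‖ ^ 2) := by
  obtain ⟨a, ha, hs⟩ := f.exists_hasSum
  have hsum : Summable fun k => ‖a k‖ ^ 2 :=
    summable_of_sum_le (fun k => by positivity) hs
  -- The first `N` terms of the series contribute the constant `C`; the tail, of square sum below `η
  -- ^ 2`, contributes the singular term.
  obtain ⟨N, hN⟩ := ((tendsto_sum_nat_add fun k => ‖a k‖ ^ 2).eventually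
    (gt_mem_nhds (show 0 < η ^ 2 by positivity))).exists
  refine ⟨∑ k ∈ Finset.range N, ‖a k‖, fun z => ?_⟩
  have hz1 : ‖(z : ℂ)‖ ^ 2 < 1 := by nlinarith [z.norm_lt_one, norm_nonneg (z : ℂ)]
  have hgeo : HasSum (fun k => (‖(z : ℂ)‖ ^ k) ^ 2) (1 - ‖(z : ℂ)‖ ^ 2)⁻¹ := by
    simpa only [← pow_mul, mul_comm] using hasSum_geometric_of_lt_one (sq_nonneg ‖(z : ℂ)‖) hz1
  have htail : Summable fun k => ‖a (k + N)‖ ^ 2 := (summable_nat_add_iff N).2 hsum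
  set u := √(1 - ‖(z : ℂ)‖ ^ 2) with hu
  have hupos : 0 < u := Real.sqrt_pos.2 (by linarith)
  have husq : u ^ 2 = 1 - ‖(z : ℂ)‖ ^ 2 := Real.sq_sqrt (by linarith)
  -- the inequality of arithmetic and geometric means, weighted by `η * u`
  have hterm (k : ℕ) : ‖a (k + N) * (z : ℂ) ^ (k + N)‖ ≤
      (‖a (k + N)‖ ^ 2 * (η * u)⁻¹ + (‖(z : ℂ)‖ ^ k) ^ 2 * (η * u)) / 2 := by
    have h1 : ‖a (k + N) * (z : ℂ) ^ (k + N)‖ ≤ ‖a (k + N)‖ * ‖(z : ℂ)‖ ^ k := by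
      rw [norm_mul, norm_pow]
      exact mul_le_mul_of_nonneg_left
        (pow_le_pow_of_le_one (norm_nonneg _) z.norm_lt_one.le (by omega)) (norm_nonneg _)
    refine h1.trans ?_
    have hp : 0 < η * u := by positivity
    have h2 := sq_nonneg (‖a (k + N)‖ - ‖(z : ℂ)‖ ^ k * (η * u))
    rw [le_div_iff₀ two_pos, ← sub_nonneg]
    have : ‖a (k + N)‖ ^ 2 * (η * u)⁻¹ + (‖(z : ℂ)‖ ^ k) ^ 2 * (η * u) -
        ‖a (k + N)‖ * ‖(z : ℂ)‖ ^ k * 2 =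
        (‖a (k + N)‖ - ‖(z : ℂ)‖ ^ k * (η * u)) ^ 2 * (η * u)⁻¹ := by
      field_simp
      ring
    rw [this]
    positivity
  have hmaj := ((htail.hasSum.mul_right (η * u)⁻¹).add (hgeo.mul_right (η * u))).div_const 2
  have hnorm : Summable fun k => ‖a (k + N) * (z : ℂ) ^ (k + N)‖ :=
    hmaj.summable.of_nonneg_of_le (fun k => norm_nonneg _) hterm
  have hsplit := (ha z).summable.sum_add_tsum_nat_add N
  rw [(ha z).tsum_eq] at hsplit
  rw [← hsplit]
  refine (norm_add_le _ _).trans (add_le_add ?_ ?_)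
  · refine (norm_sum_le _ _).trans (Finset.sum_le_sum fun k _ => ?_)
    rw [norm_mul, norm_pow]
    exact mul_le_of_le_one_right (norm_nonneg _) (pow_le_one₀ (norm_nonneg _) z.norm_lt_one.le)
  · refine (norm_tsum_le_tsum_norm hnorm).trans ((hnorm.tsum_le_tsum hterm hmaj.summable).trans ?_)
    rw [hmaj.tsum_eq, ← husq]
    have : (∑' k, ‖a (k + N)‖ ^ 2) * (η * u)⁻¹ ≤ η ^ 2 * (η * u)⁻¹ := by gcongr
    refine (div_le_div_of_nonneg_right (add_le_add_left this _) zero_le_two).trans_eq ?_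
    field_simp
    ring

/-! ### Parabolic self-maps -/

theorem IsInducedBy.isHolomorphicOnDisc {φ : 𝔻 → 𝔻} {g : GL (Fin 2) ℂ} (h : IsInducedBy φ g) :
    IsHolomorphicOnDisc fun z => (φ z : ℂ) := by
  rw [isInducedBy_iff] at h
  have hd : DifferentiableOn ℂ (fun z : ℂ => (g 0 0 * z + g 0 1) / (g 1 0 * z + g 1 1))
      (Metric.ball 0 1) := by
    refine DifferentiableOn.div (by fun_prop) (by fun_prop) fun z hz => ?_
    exact (h (UnitDisc.mk z (by simpa using hz))).1
  refine hd.congr fun z hz => ?_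
  have hz' : ‖z‖ < 1 := by simpa using hz
  simpa [discExt, hz'] using (h (UnitDisc.mk z hz')).2

theorem IsInducedBy.iterate {φ : 𝔻 → 𝔻} {g : GL (Fin 2) ℂ} (h : IsInducedBy φ g) (n : ℕ) :
    IsInducedBy (φ^[n]) (g ^ n) := by
  induction n with
  | zero => intro z; simp
  | succ n ih =>
    intro z
    rw [pow_succ', mul_smul, ih z, h, Function.iterate_succ_apply']

/-- Finite fixed points are the roots of a polynomial of degree at most two with this discriminant.
If `g 1 0 ≠ 0`, its two roots must coincide. If `g 1 0 = 0`, then `∞` is fixed, and `g 0 0 ≠ g 1 1`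
would produce a second, finite fixed point. -/
theorem discr_eq_zero_of_existsUnique_fixed {g : GL (Fin 2) ℂ}
    (h : ∃! p : OnePoint ℂ, g • p = p) :
    (g 0 0 - g 1 1) ^ 2 + 4 * g 0 1 * g 1 0 = 0 := by
  have hfix (z : ℂ) (hz : g 1 0 * z ^ 2 + (g 1 1 - g 0 0) * z - g 0 1 = 0) :
      g • (z : OnePoint ℂ) = z := by
    rw [← Matrix.GeneralLinearGroup.fixpointPolynomial_aeval_eq_zero_iff]
    simpa [Matrix.GeneralLinearGroup.fixpointPolynomial] using hz
  by_cases hc : g 1 0 = 0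
  · have hda : g 0 0 - g 1 1 = 0 := by
      by_contra hne
      have hne' : g 1 1 - g 0 0 ≠ 0 := fun h => hne (by linear_combination -h)
      have h1 := hfix (g 0 1 / (g 1 1 - g 0 0)) (by rw [hc]; field_simp; ring)
      exact OnePoint.coe_ne_infty _ (h.unique h1 (OnePoint.smul_infty_eq_self_iff.2 hc))
    simp [hc, hda]
  · obtain ⟨s, hs⟩ := IsAlgClosed.exists_pow_nat_eq
      ((g 0 0 - g 1 1) ^ 2 + 4 * g 0 1 * g 1 0) two_pos
    have h1 := hfix ((g 0 0 - g 1 1 + s) / (2 * g 1 0)) (by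
      field_simp; linear_combination hs)
    have h2 := hfix ((g 0 0 - g 1 1 - s) / (2 * g 1 0)) (by
      field_simp; linear_combination hs)
    have h3 := OnePoint.coe_injective (h.unique h1 h2)
    have h4 : s = 0 := by
      field_simp at h3
      linear_combination h3 / 2
    rw [← hs, h4]; simp

/-- Positivity at all integers rules out `A < 0`, and forces `B ≥ 0` if `A = 0`. If `A > 0`, the
values are at least `1` once `n ≥ -B / A`, leaving finitely many positive values. -/
theorem exists_pos_le_quadratic_natCast {A B : ℝ} (h : ∀ n : ℕ, 0 < 1 + B * n + A * n ^ 2) :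
    ∃ c > 0, ∀ n : ℕ, c ≤ 1 + B * n + A * n ^ 2 := by
  rcases lt_trichotomy A 0 with hA | rfl | hA
  · exfalso
    obtain ⟨n, hn⟩ := exists_nat_ge (max 1 ((1 + |B|) / -A))
    have h1 : (1 : ℝ) ≤ n := (le_max_left _ _).trans hn
    have h2 : 1 + |B| ≤ n * -A := (div_le_iff₀ (by linarith)).1 ((le_max_right _ _).trans hn)
    nlinarith [h n, le_abs_self B]
  · have hB : 0 ≤ B := by
      by_contra! hB
      obtain ⟨n, hn⟩ := exists_nat_ge (1 / -B)
      have := (div_le_iff₀ (by linarith)).1 hn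
      linarith [h n]
    exact ⟨1, one_pos, fun n => by nlinarith [n.cast_nonneg (α := ℝ)]⟩
  · obtain ⟨N, hN⟩ := exists_nat_ge (-B / A)
    obtain ⟨m, -, hm⟩ := (Finset.range (N + 1)).exists_min_image
      (fun n : ℕ => 1 + B * n + A * (n : ℝ) ^ 2) ⟨0, by simp⟩
    refine ⟨min 1 (1 + B * m + A * (m : ℝ) ^ 2), lt_min one_pos (h m), fun n => ?_⟩
    rcases Nat.lt_or_ge n (N + 1) with hn | hn
    · exact (min_le_right _ _).trans (hm n (by simpa using hn))
    · refine (min_le_left _ _).trans ?_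
      have h1 : (N : ℝ) ≤ n := by exact_mod_cast (by omega : N ≤ n)
      have h2 : -B ≤ n * A := (div_le_iff₀ hA).1 (hN.trans h1)
      nlinarith [n.cast_nonneg (α := ℝ)]

/-- Orbits of a parabolic self-map approach the boundary at most quadratically. -/
theorem IsParabolicSelfMap.exists_le_one_sub_norm_sq {φ : 𝔻 → 𝔻} (hφ : IsParabolicSelfMap φ) :
    ∃ c > 0, ∀ n : ℕ, 1 ≤ n → c / n ^ 2 ≤ 1 - ‖(φ^[n] 0 : ℂ)‖ ^ 2 := by
  obtain ⟨g, hg, hfix⟩ := hφ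
  have hdisc := discr_eq_zero_of_existsUnique_fixed hfix
  set l : ℂ := (g 0 0 + g 1 1) / 2 with hl
  set p : ℂ := (g 0 0 - g 1 1) / 2 with hp
  have hpq : p ^ 2 + g 0 1 * g 1 0 = 0 := by rw [hp]; linear_combination hdisc / 4
  have hl0 : l ≠ 0 := by
    intro h0
    refine g.det_ne_zero ?_
    rw [Matrix.det_fin_two]
    linear_combination l * h0 - hdisc / 4
  -- Here `g = l + N` with `N² = 0` by `hpq`, so `g ^ n = l ^ n + n * l ^ (n - 1) * N`. Only the
  -- second column is needed for the orbit of `0`; the factor `l` avoids the exponent `n - 1`.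
  have hpow (n : ℕ) : l * (g ^ n) 0 1 = n * l ^ n * g 0 1 ∧
      l * (g ^ n) 1 1 = l ^ n * (l - n * p) := by
    have h00 : g 0 0 = l + p := by rw [hl, hp]; ring
    have h11 : g 1 1 = l - p := by rw [hl, hp]; ring
    induction n with
    | zero => simp
    | succ n ih =>
      obtain ⟨h1, h2⟩ := ih
      have e1 : (g ^ (n + 1)) 0 1 = g 0 0 * (g ^ n) 0 1 + g 0 1 * (g ^ n) 1 1 := by
        rw [pow_succ']; simp [Matrix.mul_apply]
      have e2 : (g ^ (n + 1)) 1 1 = g 1 0 * (g ^ n) 0 1 + g 1 1 * (g ^ n) 1 1 := by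
        rw [pow_succ']; simp [Matrix.mul_apply]
      rw [e1, e2, h00, h11]
      push_cast
      constructor
      · linear_combination (l + p) * h1 + g 0 1 * h2
      · linear_combination g 1 0 * h1 + (l - p) * h2 + n * l ^ n * hpq
  set α := p / l with hα
  set β := g 0 1 / l with hβ
  have horbit (n : ℕ) : (1 - n * α : ℂ) ≠ 0 ∧ (φ^[n] 0 : ℂ) = n * β / (1 - n * α) := by
    obtain ⟨h1, h2⟩ := (isInducedBy_iff _ _).1 (hg.iterate n) 0
    simp only [UnitDisc.coe_zero, mul_zero, zero_add] at h1 h2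
    have e1 : (g ^ n) 0 1 = l ^ n * (n * β) := by
      refine mul_left_cancel₀ hl0 ((hpow n).1.trans ?_)
      rw [hβ]; field_simp
    have e2 : (g ^ n) 1 1 = l ^ n * (1 - n * α) := by
      refine mul_left_cancel₀ hl0 ((hpow n).2.trans ?_)
      rw [hα]; field_simp
    rw [e2] at h1 h2
    rw [e1] at h2
    exact ⟨right_ne_zero_of_mul h1, by rw [h2, mul_div_mul_left _ _ (pow_ne_zero n hl0)]⟩
  -- Clearing the denominator turns the distance to the boundary into a real quadratic in `n` with
  -- constant term `1`, positive because the orbit stays in the disc.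
  have hquad (n : ℕ) : (1 - ‖(φ^[n] 0 : ℂ)‖ ^ 2) * ‖(1 - n * α : ℂ)‖ ^ 2 =
      1 + (-2 * α.re) * n + (‖α‖ ^ 2 - ‖β‖ ^ 2) * n ^ 2 := by
    obtain ⟨h1, h2⟩ := horbit n
    have h3 : ‖(1 - n * α : ℂ)‖ ≠ 0 := norm_ne_zero_iff.2 h1
    rw [h2, norm_div, norm_mul]
    field_simp
    simp only [Complex.sq_norm, Complex.normSq_apply, norm_natCast]
    simp
    ring
  have hpos (n : ℕ) : 0 < 1 - ‖(φ^[n] 0 : ℂ)‖ ^ 2 := by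
    nlinarith [(φ^[n] 0).norm_lt_one, norm_nonneg (φ^[n] 0 : ℂ)]
  obtain ⟨c, hc, hcle⟩ := exists_pos_le_quadratic_natCast (A := ‖α‖ ^ 2 - ‖β‖ ^ 2)
    (B := -2 * α.re) fun n => by
      rw [← hquad]
      exact mul_pos (hpos n) (pow_pos (norm_pos_iff.2 (horbit n).1) 2)
  refine ⟨c / (1 + ‖α‖) ^ 2, by positivity, fun n hn => ?_⟩
  have hn' : (1 : ℝ) ≤ n := by exact_mod_cast hn
  have hden : ‖(1 - n * α : ℂ)‖ ≤ (1 + ‖α‖) * n := by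
    refine (norm_sub_le _ _).trans ?_
    rw [norm_one, norm_mul, norm_natCast]
    nlinarith
  rw [div_div, ← mul_pow, div_le_iff₀ (by positivity)]
  refine ((hcle n).trans_eq (hquad n).symm).trans ?_
  exact mul_le_mul_of_nonneg_left (pow_le_pow_left₀ (norm_nonneg _) hden 2) (hpos n).le

/-! ### Failure of shadowing -/

theorem one_mem_hardySubmodule : (1 : 𝔻 → ℂ) ∈ hardySubmodule := by
  have hhol : IsHolomorphicOnDisc 1 := by
    refine (differentiableOn_const (1 : ℂ)).congr fun z hz => ?_
    have hz' : ‖z‖ < 1 := by simpa using hz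
    simp [discExt, hz']
  refine ⟨hhol, ENNReal.rpow_lt_top_of_nonneg (by norm_num) (ne_top_of_le_ne_top
    ENNReal.one_ne_top (iSup₂_le fun r hr => ?_))⟩
  rw [integralMean_eq hhol hr, Real.circleAverage_congr_sphere (f₂ := fun _ => 1),
    Real.circleAverage_const, ENNReal.ofReal_one]
  intro z hz
  have hz' : ‖z‖ < 1 := by
    have : ‖z‖ = r := by simpa [abs_of_pos hr.1] using hz
    rw [this]; exact hr.2
  simp [discExt, hz']

theorem IsCompositionOperator.pow_apply {φ : 𝔻 → 𝔻} {T : HardySpace →L[ℂ] HardySpace}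
    (hT : IsCompositionOperator φ T) (n : ℕ) (f : HardySpace) (z : 𝔻) :
    (T ^ n) f z = f (φ^[n] z) := by
  induction n generalizing z with
  | zero => rfl
  | succ n ih =>
    rw [pow_succ', mul_apply_eq_comp, hT, ih, Function.iterate_succ_apply]

theorem IsParabolicSelfMap.not_hasPositiveShadowing {φ : 𝔻 → 𝔻} (hφ : IsParabolicSelfMap φ)
    {T : HardySpace →L[ℂ] HardySpace} (hT : IsCompositionOperator φ T) :
    ¬ HasPositiveShadowing T := by
  intro hsh
  obtain ⟨δ, hδ, hsh⟩ := hsh 1 one_pos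
  let e : HardySpace := ⟨1, one_mem_hardySubmodule⟩
  have hTe : T e = e := HardySpace.ext fun z => hT e z
  -- The denominator `1 + ‖e‖` makes the value of `‖e‖` irrelevant.
  obtain ⟨d, hd, hde⟩ : ∃ d : ℝ, 0 < d ∧ d * ‖e‖ ≤ δ := by
    refine ⟨δ / (1 + ‖e‖), by positivity, ?_⟩
    rw [div_mul_eq_mul_div, div_le_iff₀ (by positivity)]
    nlinarith [norm_nonneg e]
  obtain ⟨y, hy⟩ := hsh (fun n => ((d * n : ℝ) : ℂ) • e) fun n _ => by
    rw [map_smul, hTe, ← sub_smul, norm_smul, ← ofReal_sub, norm_real]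
    push_cast
    rw [show d * n - d * (n + 1) = -d by ring, norm_neg, Real.norm_of_nonneg hd.le]
    exact hde
  obtain ⟨c, hc, hcle⟩ := hφ.exists_le_one_sub_norm_sq
  -- With this `η`, the singular term at `φ^[n] 0` is at most `d / 2 * n`, half the drift of the
  -- pseudo-orbit.
  obtain ⟨C, hC⟩ := y.exists_norm_apply_le (η := d / 2 * √c) (by positivity)
  have hbound (n : ℕ) (hn : 1 ≤ n) : d * n ≤ 1 + C + d / 2 * n := by
    have hn' : (0 : ℝ) < n := by exact_mod_cast hn
    have h1 := (HardySpace.norm_apply_zero_le _).trans (hy n hn)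
    have h2 : ((T ^ n) y - ((d * n : ℝ) : ℂ) • e : HardySpace) 0 =
        y (φ^[n] 0) - ((d * n : ℝ) : ℂ) := by
      rw [← hT.pow_apply]
      change (T ^ n) y 0 - ((d * n : ℝ) : ℂ) * 1 = _
      rw [mul_one]
    rw [h2] at h1
    have h3 : d * n ≤ 1 + ‖y (φ^[n] 0)‖ := by
      have := norm_sub_norm_le ((d * n : ℝ) : ℂ) (y (φ^[n] 0))
      rw [norm_sub_rev, norm_real, Real.norm_of_nonneg (by positivity)] at this
      linarith
    have h4 : d / 2 * √c / √(1 - ‖(φ^[n] 0 : ℂ)‖ ^ 2) ≤ d / 2 * n := by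
      have h5 : √c / n ≤ √(1 - ‖(φ^[n] 0 : ℂ)‖ ^ 2) := by
        refine le_trans (le_of_eq ?_) (Real.sqrt_le_sqrt (hcle n hn))
        rw [Real.sqrt_div hc.le, Real.sqrt_sq hn'.le]
      have h6 : 0 < √c / n := by positivity
      rw [div_le_iff₀ (h6.trans_le h5), mul_assoc]
      refine mul_le_mul_of_nonneg_left ?_ (by positivity)
      rwa [div_le_iff₀' hn'] at h5
    linarith [hC (φ^[n] 0)]
  obtain ⟨n, hn⟩ := exists_nat_gt (max 1 ((1 + C) / (d / 2)))
  have h1 : (1 : ℝ) < n := (le_max_left _ _).trans_lt hn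
  have h2 := (div_lt_iff₀ (by positivity)).1 ((le_max_right _ _).trans_lt hn)
  have h3 := hbound n (by exact_mod_cast h1.le)
  linarith

end HardyShadowing

end

theorem mainTheorem4 (φ : Complex.UnitDisc → Complex.UnitDisc)
    (hφ : HardyShadowing.IsParabolicSelfMap φ) :
    ∃ T : HardyShadowing.HardySpace →L[ℂ] HardyShadowing.HardySpace,
      HardyShadowing.IsCompositionOperator φ T ∧ ¬ HardyShadowing.HasPositiveShadowing T := by
  obtain ⟨T, hT⟩ := HardyShadowing.exists_isCompositionOperator
    (hφ.choose_spec.1.isHolomorphicOnDisc)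
  exact ⟨T, hT, hφ.not_hasPositiveShadowing hT⟩
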